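/- Let $\log^+x=\max(\log x,0)$, $\log^-x=\max(-\log x,0)$. A standard complex Gaussian is a complex random variable with density $\frac1\pi e^{-|z|^2}$ with respect to Lebesgue measure on $\mathbb C$. Put $$r_0=1,\quad k_0=0,\qquad r_m=\exp(21^m),\quad k_m=\lfloor \exp(20^m)\rfloor,\quad \eta_m=\exp\!\left(-\tfrac{19}{10}\,20^m\right)\qquad(m\ge1),$$ and define coefficients in blocks by $a_0=1$ and $a_j=r_m^{-j}$ for $k_{m-1}<j\le k_m$, $m\ge 1$, so that $a_jr_m^j=1$ for every $j$ in the $m$-th block. Let $$S(r)=2\sum_{n\ge0}\log^+(a_nr^n),\qquad E=\bigcup_{m\ge1}[r_m,\,r_me^{\eta_m}].$$ Then $\sum_n a_nz^n$ is a non-constant entire function, and $E$ has infinite Lebesgue measure. Moreover there is a constant $C>0$ such that, for every sequence $(\xi_n)_{n\ge0}$ of i.i.d. standard complex Gaussians on a probability space, the Gaussian analytic function $f(z)=\sum_{n\ge0}\xi_na_nz^n$ is almost surely entire, the hole probability $P_H(f;r)=\mathcal P\left(f(z)\neq0\text{ for all }|z|\le r\right)$ is positive for every $r$, and $p_H(f;r)=\log^-P_H(f;r)$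 satisfies $$p_H(f;r)\ \ge\ 2S(r)-C\sqrt{S(r)}\qquad\text{for all } r\in E.$$ Consequently an exceptional set in the asymptotics of the hole probability cannot be removed in general: if $0<\varepsilon<\frac12$ and $F\subseteq[1,\infty)$ is a set such that $p_H(f;r)=S(r)+O\!\left(S(r)^{1/2+\varepsilon}\right)$ as $r\to\infty$ with $r\notin F$, then $F$ has infinite Lebesgue measure (in particular, $F$ is not empty). -/

import Mathlib

open Real Set Filter Topology MeasureTheory ProbabilityTheory Asymptotics

namespace HoleProb

noncomputable section

/-- The law of a standard complex Gaussian: density `π⁻¹ exp (-|z|²)` with respect to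
Lebesgue measure on `ℂ`. -/
def stdComplexGaussian : Measure ℂ :=
  volume.withDensity fun z => ENNReal.ofReal (π⁻¹ * Real.exp (-‖z‖ ^ 2))

/-- The random power series `f(z) = ∑ ξ_n a_n z^n`. -/
def gaf {Ω : Type*} (a : ℕ → ℝ) (ξ : ℕ → Ω → ℂ) (ω : Ω) (z : ℂ) : ℂ :=
  ∑' n, ξ n ω * (a n : ℂ) * z ^ n

/-- The hole event: `f` has no zero in the closed disk `|z| ≤ r`. -/
def holeEvent {Ω : Type*} (a : ℕ → ℝ) (ξ : ℕ → Ω → ℂ) (r : ℝ) : Set Ω :=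
  {ω | ∀ z : ℂ, ‖z‖ ≤ r → gaf a ξ ω z ≠ 0}

/-- `p_H(f; r) = log⁻ P(hole)`, where `log⁻ x = max (-log x) 0`. -/
def pH {Ω : Type*} [MeasurableSpace Ω] (P : Measure Ω) (a : ℕ → ℝ) (ξ : ℕ → Ω → ℂ) (r : ℝ) : ℝ :=
  max (-Real.log (P.real (holeEvent a ξ r))) 0

/-- `S(r) = 2 ∑ log⁺ (a_n r^n)`; when `∑ a_n z^n` is entire only finitely many terms are nonzero. -/
def S (a : ℕ → ℝ) (r : ℝ) : ℝ :=
  2 * ∑' n, Real.posLog (a n * r ^ n)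

/-- The radii `r_0 = 1` and `r_m = exp (21^m)` for `m ≥ 1`. -/
def radius (m : ℕ) : ℝ := if m = 0 then 1 else Real.exp (21 ^ m)

/-- The block ends `k_0 = 0` and `k_m = [exp (20^m)]` for `m ≥ 1`. The `m`-th block of indices is
`{k_{m-1} + 1, …, k_m}`. -/
def blockEnd (m : ℕ) : ℕ := if m = 0 then 0 else ⌊Real.exp (20 ^ m)⌋₊

/-- The number of the block that contains `j` (the least `m` with `j ≤ k_m`). -/
def blockIndex (j : ℕ) : ℕ := sInf {m | j ≤ blockEnd m}

/-- The coefficients: `a_0 = 1`, and `a_j = r_m ^ (-j)` for `j` in the `m`-th block. -/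
def coeff (j : ℕ) : ℝ := (radius (blockIndex j) ^ j)⁻¹

/-- `η_m = exp (-(19/10) 20^m)`. -/
def eta (m : ℕ) : ℝ := Real.exp (-(19 / 10) * 20 ^ m)

/-- The set of radii `E = ⋃_{m ≥ 1} [r_m, r_m exp (η_m)]`. -/
def badRadii : Set ℝ :=
  ⋃ m : ℕ, ⋃ _ : 1 ≤ m, Icc (radius m) (radius m * Real.exp (eta m))

end

end HoleProb

/-!
On the circle `|z| = r_m` the terms of the `m`-th block all have `a_j r_m ^ j = 1`. There are
`M = k_m - k_{m-1}` of them, about `x ^ 20` with `x = exp (20 ^ (m - 1))`, while `S` is at most of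
order `x ^ 3` on `[r_m, r_m exp η_m]` (`S_coeff_le`). It is therefore enough that a hole of
radius `r_m` has probability exponentially small in `M` (`measure_holeEvent_le`): this gives
`2 S ≤ p_H` on the whole set of radii, and any constant `C > 0` will do.

For the exponential bound, let `ζ` be a primitive `M`-th root of unity. If `f` has no zero in the
disk, then `z ↦ ∏_{k < M} 1 / f (ζ ^ k z)` is holomorphic there, and its mean value property gives
`|f 0| ^ (-M) ≤ ⨍ ∏_k |f (ζ ^ k r e^{iθ})|⁻¹ dθ`. Condition on the coefficients outside the block.
Since the block contributes a multiple of a unitary matrix applied to independent Gaussians, the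
values of `f` at the `M` points are independent Gaussians of variance `M` with arbitrary means
(`map_pi_stdComplexGaussian`), so the expectation of the product is at most `(3 / √M) ^ M`. Either
`|f 0|` exceeds `√M / 6`, which has probability at most `2 exp (-M / 72)`, or Markov's inequality
gives a factor `2 ^ (-M)`. The argument is carried out for partial sums and passed to the limit by
Fatou's lemma.

The hole probability is positive because the constant term is unbounded and independent of the sum
of the moduli of the other terms. Finally, on the set of radii `p_H - S ≥ S`, and `S → ∞`, so an
exceptional set must contain all but a bounded part of the set of radii, whose measure is infinite.
-/

namespace HoleProb

open scoped ENNReal ComplexConjugate RealInnerProductSpace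

/-! ### The standard complex Gaussian -/

lemma measurable_stdComplexGaussian_density :
    Measurable fun z : ℂ => ENNReal.ofReal (π⁻¹ * Real.exp (-‖z‖ ^ 2)) := by
  fun_prop

lemma lintegral_stdComplexGaussian {f : ℂ → ℝ≥0∞} (hf : Measurable f) :
    ∫⁻ z, f z ∂stdComplexGaussian =
      ∫⁻ z, ENNReal.ofReal (π⁻¹ * Real.exp (-‖z‖ ^ 2)) * f z := by
  rw [stdComplexGaussian, lintegral_withDensity_eq_lintegral_mul _
    measurable_stdComplexGaussian_density hf]
  rfl

/-- The planar Gaussian integral. -/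
lemma lintegral_exp_neg_mul_norm_sq {b : ℝ} (hb : 0 < b) :
    ∫⁻ z : ℂ, ENNReal.ofReal (Real.exp (-b * ‖z‖ ^ 2)) = ENNReal.ofReal (π / b) := by
  have h := GaussianFourier.integral_rexp_neg_mul_sq_norm (V := ℂ) hb
  rw [Complex.finrank_real_complex] at h
  have h' : ∫ z : ℂ, Real.exp (-b * ‖z‖ ^ 2) = π / b := by
    rw [h]; norm_num
  rw [← h', ofReal_integral_eq_lintegral_ofReal _ (Eventually.of_forall fun _ => by positivity)]
  by_contra hint
  rw [integral_undef hint] at h'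
  exact (div_pos pi_pos hb).ne h'

lemma lintegral_exp_norm_sq_stdComplexGaussian {c : ℝ} (hc : c < 1) :
    ∫⁻ z, ENNReal.ofReal (Real.exp (c * ‖z‖ ^ 2)) ∂stdComplexGaussian =
      ENNReal.ofReal (1 - c)⁻¹ := by
  rw [lintegral_stdComplexGaussian (by fun_prop)]
  have : ∀ z : ℂ, ENNReal.ofReal (π⁻¹ * Real.exp (-‖z‖ ^ 2)) *
      ENNReal.ofReal (Real.exp (c * ‖z‖ ^ 2)) =
      ENNReal.ofReal π⁻¹ * ENNReal.ofReal (Real.exp (-(1 - c) * ‖z‖ ^ 2)) := by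
    intro z
    rw [← ENNReal.ofReal_mul (by positivity), ← ENNReal.ofReal_mul (by positivity), mul_assoc,
      ← Real.exp_add]
    ring_nf
  simp_rw [this]
  rw [lintegral_const_mul _ (by fun_prop), lintegral_exp_neg_mul_norm_sq (by linarith),
    ← ENNReal.ofReal_mul (by positivity)]
  congr 1
  field_simp

instance : IsProbabilityMeasure stdComplexGaussian := by
  constructor
  have := lintegral_exp_norm_sq_stdComplexGaussian (c := 0) one_pos
  simpa using this

lemma charFun_stdComplexGaussian (t : ℂ) :
    charFun stdComplexGaussian t = Complex.exp (-(‖t‖ ^ 2 / 4 : ℝ)) := by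
  have h := GaussianFourier.integral_cexp_neg_mul_sq_norm_add (V := ℂ) (b := 1) (by simp)
    Complex.I t
  rw [Complex.finrank_real_complex] at h
  rw [charFun_apply, stdComplexGaussian,
    integral_withDensity_eq_integral_toReal_smul measurable_stdComplexGaussian_density
      (by simp)]
  have : ∀ x : ℂ, (ENNReal.ofReal (π⁻¹ * Real.exp (-‖x‖ ^ 2))).toReal •
      Complex.exp (⟪x, t⟫ * Complex.I) =
      (π : ℂ)⁻¹ * Complex.exp (-1 * (‖x‖ : ℂ) ^ 2 + Complex.I * ⟪t, x⟫) := by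
    intro x
    rw [ENNReal.toReal_ofReal (by positivity), Complex.real_smul, Complex.exp_add,
      real_inner_comm]
    push_cast
    rw [mul_assoc, neg_one_mul, mul_comm Complex.I]
  simp_rw [this]
  rw [integral_const_mul, h, Complex.I_sq]
  norm_num
  rw [neg_div]

lemma lintegral_enorm_stdComplexGaussian_lt_top :
    ∫⁻ z, ‖z‖ₑ ∂stdComplexGaussian < ∞ := by
  refine lt_of_le_of_lt (lintegral_mono fun z => ?_)
    ((lintegral_exp_norm_sq_stdComplexGaussian (c := 1 / 2) (by norm_num)).trans_lt
      ENNReal.ofReal_lt_top)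
  rw [← ofReal_norm]
  refine ENNReal.ofReal_le_ofReal ?_
  nlinarith [Real.add_one_le_exp (1 / 2 * ‖z‖ ^ 2), sq_nonneg (‖z‖ - 1)]

lemma stdComplexGaussian_lt_norm_le {T : ℝ} (hT : 0 ≤ T) :
    stdComplexGaussian {z | T < ‖z‖} ≤ ENNReal.ofReal (2 * Real.exp (-T ^ 2 / 2)) := by
  have h1 := mul_meas_ge_le_lintegral (μ := stdComplexGaussian)
    (f := fun z : ℂ => ENNReal.ofReal (Real.exp (1 / 2 * ‖z‖ ^ 2))) (by fun_prop)
    (ENNReal.ofReal (Real.exp (T ^ 2 / 2)))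
  rw [lintegral_exp_norm_sq_stdComplexGaussian (by norm_num)] at h1
  have h2 : stdComplexGaussian {z | T < ‖z‖} ≤ stdComplexGaussian
      {z | ENNReal.ofReal (Real.exp (T ^ 2 / 2)) ≤
        ENNReal.ofReal (Real.exp (1 / 2 * ‖z‖ ^ 2))} := by
    refine measure_mono fun z (hz : T < ‖z‖) => ?_
    refine ENNReal.ofReal_le_ofReal (Real.exp_le_exp.2 ?_)
    nlinarith
  refine h2.trans ?_
  rw [mul_comm, ← ENNReal.le_div_iff_mul_le (by simp [Real.exp_pos]) (by simp)] at h1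
  refine h1.trans (le_of_eq ?_)
  rw [← ENNReal.ofReal_div_of_pos (by positivity), neg_div, Real.exp_neg]
  norm_num [div_eq_mul_inv]

lemma stdComplexGaussian_lt_norm_pos (T : ℝ) : 0 < stdComplexGaussian {z | T < ‖z‖} := by
  have hac : (volume : Measure ℂ) ≪ stdComplexGaussian :=
    withDensity_absolutelyContinuous' measurable_stdComplexGaussian_density.aemeasurable
      (Eventually.of_forall fun z => by
        simp only [ne_eq, ENNReal.ofReal_eq_zero, not_le]; positivity)
  rw [pos_iff_ne_zero]
  intro h0
  have hopen : IsOpen {z : ℂ | T < ‖z‖} := isOpen_lt continuous_const continuous_norm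
  refine (hopen.measure_pos volume ⟨((|T| + 1 : ℝ) : ℂ), ?_⟩).ne' (hac h0)
  simp only [mem_ofPred_eq, Complex.norm_real, Real.norm_eq_abs]
  rw [abs_of_pos (by positivity)]
  linarith [le_abs_self T]

lemma lintegral_ball_enorm_inv :
    ∫⁻ z in {z : ℂ | ‖z‖ < 1}, ‖z‖ₑ⁻¹ ≤ ENNReal.ofReal (2 * π) := by
  rw [← lintegral_indicator (measurableSet_lt measurable_norm measurable_const),
    ← Complex.lintegral_comp_polarCoord_symm]
  calc _ ≤ ∫⁻ p in polarCoord.target, (Ioo 0 1 ×ˢ Ioo (-π) π).indicator 1 p := by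
        refine setLIntegral_mono_ae' polarCoord.open_target.measurableSet
          (Eventually.of_forall fun p hp => ?_)
        rw [polarCoord_target] at hp
        have hp0 : 0 < p.1 := hp.1
        have hn : ‖Complex.polarCoord.symm p‖ = p.1 := by
          rw [Complex.norm_polarCoord_symm, abs_of_pos hp0]
        by_cases h1 : p.1 < 1
        · have hmem : p ∈ Ioo (0:ℝ) 1 ×ˢ Ioo (-π) π := ⟨⟨hp0, h1⟩, hp.2⟩
          rw [indicator_of_mem hmem, indicator_of_mem (by simpa only [mem_ofPred_eq, hn] using h1), ← ofReal_norm, hn,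
            smul_eq_mul, ENNReal.mul_inv_cancel (by simpa using hp0) (by simp)]
          rfl
        · rw [indicator_of_notMem (s := {z : ℂ | ‖z‖ < 1})
            (by simpa only [mem_ofPred_eq, hn] using h1)]
          simp
    _ ≤ ∫⁻ p : ℝ × ℝ, (Ioo 0 1 ×ˢ Ioo (-π) π).indicator 1 p := setLIntegral_le_lintegral _ _
    _ = ENNReal.ofReal (2 * π) := by
        rw [lintegral_indicator_one (measurableSet_Ioo.prod measurableSet_Ioo),
          Measure.volume_eq_prod, Measure.prod_prod, Real.volume_Ioo, Real.volume_Ioo]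
        norm_num [two_mul]

/-- The first inverse moment of a shifted complex Gaussian is bounded uniformly in the shift; it
is finite because `1 / |z|` is locally integrable in the plane. -/
lemma lintegral_enorm_inv_stdComplexGaussian_le (c : ℂ) :
    ∫⁻ z, ‖c + z‖ₑ⁻¹ ∂stdComplexGaussian ≤ 3 := by
  have hmeas : Measurable fun z : ℂ => {z : ℂ | ‖z‖ < 1}.indicator (fun z => ‖z‖ₑ⁻¹) (c + z) :=
    (Measurable.indicator (by fun_prop)
      (measurableSet_lt measurable_norm measurable_const)).comp (measurable_const_add c)
  calc ∫⁻ z, ‖c + z‖ₑ⁻¹ ∂stdComplexGaussian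
      ≤ ∫⁻ z, (1 + {z : ℂ | ‖z‖ < 1}.indicator (fun z => ‖z‖ₑ⁻¹) (c + z))
          ∂stdComplexGaussian := by
        refine lintegral_mono fun z => ?_
        by_cases h : ‖c + z‖ < 1
        · rw [indicator_of_mem (by exact h)]
          exact le_add_self
        · refine le_add_right (ENNReal.inv_le_one.2 ?_)
          rw [← ofReal_norm, ENNReal.one_le_ofReal]
          exact not_lt.1 h
    _ = 1 + ∫⁻ z, {z : ℂ | ‖z‖ < 1}.indicator (fun z => ‖z‖ₑ⁻¹) (c + z) ∂stdComplexGaussian := by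
        rw [lintegral_add_left measurable_const]; simp
    _ ≤ 1 + ∫⁻ z, ENNReal.ofReal π⁻¹ *
          {z : ℂ | ‖z‖ < 1}.indicator (fun z => ‖z‖ₑ⁻¹) (c + z) := by
        rw [lintegral_stdComplexGaussian hmeas]
        gcongr with z
        exact mul_le_of_le_one_right (by positivity) (Real.exp_le_one_iff.2 (by simp))
    _ ≤ 1 + ENNReal.ofReal π⁻¹ * ENNReal.ofReal (2 * π) := by
        rw [lintegral_const_mul _ hmeas, lintegral_add_left_eq_self,
          lintegral_indicator (measurableSet_lt measurable_norm measurable_const)]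
        gcongr
        exact lintegral_ball_enorm_inv
    _ = 3 := by
        rw [← ENNReal.ofReal_mul (by positivity)]
        have : π⁻¹ * (2 * π) = 2 := by field_simp
        rw [this]
        norm_num

lemma lintegral_enorm_inv_smul_stdComplexGaussian_le {s : ℝ} (hs : 0 < s) (c : ℂ) :
    ∫⁻ z, ‖c + s • z‖ₑ⁻¹ ∂stdComplexGaussian ≤ ENNReal.ofReal (3 / s) := by
  have : ∀ z : ℂ, ‖c + s • z‖ₑ⁻¹ = (ENNReal.ofReal s)⁻¹ * ‖s⁻¹ • c + z‖ₑ⁻¹ := by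
    intro z
    have h1 : c + s • z = s • (s⁻¹ • c + z) := by
      rw [smul_add, smul_inv_smul₀ hs.ne']
    rw [h1, enorm_smul, ENNReal.mul_inv (by simp [hs.ne']) (by simp)]
    congr 2
    rw [Real.enorm_eq_ofReal hs.le]
  simp_rw [this]
  rw [lintegral_const_mul _ (by fun_prop), ENNReal.ofReal_div_of_pos hs, div_eq_mul_inv, mul_comm]
  gcongr
  simpa using lintegral_enorm_inv_stdComplexGaussian_le (s⁻¹ • c)

/-! ### Unitary invariance -/

/-- A matrix with orthogonal rows of equal norm `s` maps a vector of independent standard complex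
Gaussians to a vector of independent Gaussians of standard deviation `s`. -/
lemma map_pi_stdComplexGaussian {ι κ : Type*} [Fintype ι] [Fintype κ] [DecidableEq κ]
    (A : κ → ι → ℂ) (s : ℝ)
    (hA : ∀ k l, ∑ i, A k i * conj (A l i) = if k = l then (s : ℂ) ^ 2 else 0) :
    (Measure.pi fun _ : ι => stdComplexGaussian).map (fun x k => ∑ i, A k i * x i) =
      Measure.pi fun _ : κ => stdComplexGaussian.map (s • ·) := by
  have hmeas : Measurable fun (x : ι → ℂ) k => ∑ i, A k i * x i := by fun_prop
  have : IsProbabilityMeasure (stdComplexGaussian.map (s • · : ℂ → ℂ)) :=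
    Measure.isProbabilityMeasure_map (by fun_prop)
  have : IsProbabilityMeasure ((Measure.pi fun _ : ι => stdComplexGaussian).map
      (fun x k => ∑ i, A k i * x i)) := Measure.isProbabilityMeasure_map hmeas.aemeasurable
  rw [← charFun_eq_pi_iff]
  intro t
  have hright : ∀ k, charFun (stdComplexGaussian.map (s • · : ℂ → ℂ)) (t k) =
      Complex.exp (-(s ^ 2 * ‖t k‖ ^ 2 / 4 : ℝ)) := by
    intro k
    rw [charFun_map_smul, charFun_stdComplexGaussian, norm_smul, mul_pow, norm_eq_abs, sq_abs]
  simp_rw [hright]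
  have hinner : ∀ x : ι → ℂ,
      ⟪WithLp.toLp 2 (fun k => ∑ i, A k i * x i), t⟫ =
        ∑ i, ⟪x i, ∑ k, conj (A k i) * t k⟫ := by
    intro x
    simp only [PiLp.inner_apply, Complex.inner, map_sum, map_mul, Finset.mul_sum, Finset.sum_mul,
      Complex.re_sum]
    rw [Finset.sum_comm]
    refine Finset.sum_congr rfl fun i _ => Finset.sum_congr rfl fun k _ => ?_
    congr 1
    ring
  have hleft : charFun (((Measure.pi fun _ : ι => stdComplexGaussian).map
      (fun x k => ∑ i, A k i * x i)).map (WithLp.toLp 2)) t =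
      ∏ i, charFun stdComplexGaussian (∑ k, conj (A k i) * t k) := by
    have hm2 := (WithLp.measurable_toLp 2 (κ → ℂ)).comp hmeas
    rw [Measure.map_map (WithLp.measurable_toLp 2 _) hmeas, charFun_apply,
      integral_map hm2.aemeasurable (by fun_prop)]
    simp only [Function.comp_apply, hinner, charFun_apply, Complex.ofReal_sum, Finset.sum_mul,
      Complex.exp_sum]
    exact integral_fintype_prod_eq_prod
      (fun i (x : ℂ) => Complex.exp (⟪x, ∑ k, conj (A k i) * t k⟫ * Complex.I))
  rw [hleft]
  simp_rw [charFun_stdComplexGaussian]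
  rw [← Complex.exp_sum, ← Complex.exp_sum]
  congr 1
  rw [Finset.sum_neg_distrib, Finset.sum_neg_distrib, neg_inj, ← Complex.ofReal_sum,
    ← Complex.ofReal_sum, ← Finset.sum_div, ← Finset.sum_div, ← Finset.mul_sum]
  congr 2
  apply Complex.ofReal_injective
  push_cast
  simp_rw [← Complex.mul_conj', map_sum, map_mul, Complex.conj_conj, Finset.sum_mul_sum]
  rw [Finset.sum_comm, Finset.mul_sum]
  refine Finset.sum_congr rfl fun k _ => ?_
  rw [Finset.sum_comm]
  have : ∀ l, ∑ i, conj (A k i) * t k * (A l i * conj (t l)) =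
      (if l = k then (s : ℂ) ^ 2 else 0) * (t k * conj (t l)) := by
    intro l
    rw [← hA, Finset.sum_mul]
    exact Finset.sum_congr rfl fun i _ => by ring
  simp_rw [this]
  simp

lemma lintegral_prod_pi {κ : Type*} [Fintype κ] {μ : κ → Measure ℂ}
    [∀ k, IsProbabilityMeasure (μ k)] {g : κ → ℂ → ℝ≥0∞} (hg : ∀ k, Measurable (g k)) :
    ∫⁻ x, ∏ k, g k (x k) ∂Measure.pi μ = ∏ k, ∫⁻ x, g k x ∂μ k := by
  have hind : iIndepFun (fun k (x : κ → ℂ) => g k (x k)) (Measure.pi μ) :=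
    iIndepFun_pi fun k => (hg k).aemeasurable
  rw [lintegral_prod_eq_prod_lintegral_of_indepFun Finset.univ _ hind
    fun k => (hg k).comp (measurable_pi_apply k)]
  refine Finset.prod_congr rfl fun k _ => ?_
  exact (measurePreserving_eval μ k).lintegral_comp (hg k)

lemma lintegral_prod_enorm_inv_le {ι κ : Type*} [Fintype ι] [Fintype κ] [DecidableEq κ]
    (A : κ → ι → ℂ) {s : ℝ} (hs : 0 < s)
    (hA : ∀ k l, ∑ i, A k i * conj (A l i) = if k = l then (s : ℂ) ^ 2 else 0) (c : κ → ℂ) :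
    ∫⁻ x, ∏ k, ‖c k + ∑ i, A k i * x i‖ₑ⁻¹ ∂(Measure.pi fun _ : ι => stdComplexGaussian) ≤
      ENNReal.ofReal (3 / s) ^ Fintype.card κ := by
  have : IsProbabilityMeasure (stdComplexGaussian.map (s • · : ℂ → ℂ)) :=
    Measure.isProbabilityMeasure_map (by fun_prop)
  have hmeas : Measurable fun y : κ → ℂ => ∏ k, ‖c k + y k‖ₑ⁻¹ := by fun_prop
  have h := lintegral_map (μ := Measure.pi fun _ : ι => stdComplexGaussian) hmeas
    (g := fun x k => ∑ i, A k i * x i) (by fun_prop)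
  rw [← h, map_pi_stdComplexGaussian A s hA,
    lintegral_prod_pi (g := fun k y => ‖c k + y‖ₑ⁻¹) (fun k => by fun_prop)]
  calc _ ≤ ∏ _k : κ, ENNReal.ofReal (3 / s) := by
        refine Finset.prod_le_prod' fun k _ => ?_
        rw [lintegral_map (by fun_prop) (by fun_prop)]
        exact lintegral_enorm_inv_smul_stdComplexGaussian_le hs (c k)
    _ = _ := by simp

/-! ### The hole probability at a radius where a block of terms has unit size -/

/-- The mean value property of `z ↦ ∏ k, 1 / f (w k * z)`, which is holomorphic in the disk when
`f` has no zeros there. -/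
lemma enorm_inv_pow_le_lintegral_circle {f : ℂ → ℂ} (hf : Differentiable ℂ f) {r : ℝ}
    (hr : 0 ≤ r) (hf0 : ∀ z, ‖z‖ ≤ r → f z ≠ 0) {κ : Type*} [Fintype κ] (w : κ → ℂ)
    (hw : ∀ k, ‖w k‖ = 1) :
    ‖f 0‖ₑ⁻¹ ^ Fintype.card κ ≤ ENNReal.ofReal (2 * π)⁻¹ *
      ∫⁻ θ in Ioc 0 (2 * π), ∏ k, ‖f (w k * circleMap 0 r θ)‖ₑ⁻¹ := by
  set g : ℂ → ℂ := fun z => ∏ k, (f (w k * z))⁻¹ with hg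
  have hne : ∀ z, ‖z‖ ≤ r → ∀ k, f (w k * z) ≠ 0 := fun z hz k => hf0 _ (by simpa [hw] using hz)
  have hgd : ∀ z ∈ Metric.closedBall (0 : ℂ) r, DifferentiableAt ℂ g z := by
    intro z hz
    rw [mem_closedBall_zero_iff] at hz
    refine DifferentiableAt.fun_finsetProd fun k _ => DifferentiableAt.fun_inv ?_ (hne z hz k)
    exact (hf _).comp z (by fun_prop)
  have hgc : DiffContOnCl ℂ g (Metric.ball 0 |r|) := by
    rw [abs_of_nonneg hr]
    refine DifferentiableOn.diffContOnCl fun z hz => ?_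
    exact (hgd z (Metric.closure_ball_subset_closedBall hz)).differentiableWithinAt
  have hmv := hgc.circleAverage
  rw [circleAverage_def, intervalIntegral.integral_of_le (by positivity)] at hmv
  have hg0 : ‖g 0‖ₑ = ‖f 0‖ₑ⁻¹ ^ Fintype.card κ := by
    have : f 0 ≠ 0 := hf0 0 (by simpa using hr)
    simp [hg, enorm_inv (pow_ne_zero _ this), ENNReal.inv_pow]
  rw [← hg0, ← hmv, enorm_smul]
  have h2 : ‖(2 * π)⁻¹‖ₑ = ENNReal.ofReal (2 * π)⁻¹ :=
    Real.enorm_eq_ofReal (by positivity)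
  rw [h2]
  gcongr
  refine (enorm_integral_le_lintegral_enorm _).trans (lintegral_mono fun θ => ?_)
  have hθ : ‖circleMap 0 r θ‖ ≤ r := by simp [abs_of_nonneg hr]
  simp only [hg]
  rw [← ofReal_norm, norm_prod, ENNReal.ofReal_prod_of_nonneg (fun _ _ => norm_nonneg _)]
  refine (Finset.prod_congr rfl fun k _ => ?_).le
  rw [ofReal_norm, enorm_inv (hne _ hθ k)]

/-- Orthogonality of the characters of the cyclic group of order `M`, summed over any `M`
consecutive exponents and rotated by a common unimodular factor. -/
lemma sum_Ioc_pow_mul_conj_pow {M : ℕ} (N : ℕ) {ζ v : ℂ} (hζ : IsPrimitiveRoot ζ M)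
    (hv : ‖v‖ = 1) (k l : Fin M) :
    ∑ j ∈ Finset.Ioc N (N + M), (ζ ^ (k : ℕ) * v) ^ j * conj ((ζ ^ (l : ℕ) * v) ^ j) =
      if k = l then (M : ℂ) else 0 := by
  have hM : M ≠ 0 := fun h => by subst h; exact k.elim0
  have hζn : ‖ζ‖ = 1 := hζ.norm'_eq_one hM
  set q : ℂ := ζ ^ (k : ℕ) * v * conj (ζ ^ (l : ℕ) * v) with hq
  have hsum : ∑ j ∈ Finset.Ioc N (N + M), (ζ ^ (k : ℕ) * v) ^ j * conj ((ζ ^ (l : ℕ) * v) ^ j) =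
      ∑ j ∈ Finset.Ioc N (N + M), q ^ j :=
    Finset.sum_congr rfl fun j _ => by rw [map_pow, ← mul_pow]
  have hqζ : q * ζ ^ (l : ℕ) = ζ ^ (k : ℕ) := by
    have hv' : v * conj v = 1 := by rw [Complex.mul_conj', hv]; simp
    have hζ' : ζ ^ (l : ℕ) * conj (ζ ^ (l : ℕ)) = 1 := by
      rw [Complex.mul_conj', norm_pow, hζn]; simp
    calc q * ζ ^ (l : ℕ) = ζ ^ (k : ℕ) * (v * conj v) * (ζ ^ (l : ℕ) * conj (ζ ^ (l : ℕ))) := by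
          rw [hq, map_mul]; ring
      _ = ζ ^ (k : ℕ) := by rw [hv', hζ']; ring
  rw [hsum]
  split_ifs with hkl
  · subst hkl
    have hq1 : q = 1 := by
      rw [hq, Complex.mul_conj', norm_mul, norm_pow, hζn, hv]; simp
    simp [hq1]
  · have hq1 : q ≠ 1 := fun h => by
      rw [h, one_mul] at hqζ
      exact hkl (Fin.ext (hζ.pow_inj l.2 k.2 hqζ).symm)
    have hqM : q ^ M = 1 := by
      have h := congrArg (· ^ M) hqζ
      simp only [mul_pow, ← pow_mul, mul_comm _ M] at h
      simpa [pow_mul, hζ.pow_eq_one] using h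
    have hIoc : Finset.Ioc N (N + M) = Finset.Ico (N + 1) (N + 1 + M) := by
      ext j; simp only [Finset.mem_Ioc, Finset.mem_Ico]; omega
    rw [hIoc, Finset.sum_Ico_eq_sum_range, Nat.add_sub_cancel_left]
    simp_rw [pow_add q (N + 1)]
    rw [← Finset.mul_sum, geom_sum_eq hq1, hqM]
    simp

section

variable {Ω : Type*} [MeasurableSpace Ω] {P : Measure Ω} [IsProbabilityMeasure P]
  {ξ : ℕ → Ω → ℂ}

/-- The values of a random polynomial at `M` equally spaced points of the circle, given all
coefficients outside a block of `M` terms of unit size, are independent Gaussians of variance `M`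
with arbitrary means. -/
lemma lintegral_prod_enorm_inv_polynomial_le {a : ℕ → ℝ} {r : ℝ} {N M n : ℕ} (hM : 0 < M)
    (hn : N + M < n)
    (hblock : ∀ j ∈ Finset.Ioc N (N + M), a j * r ^ j = 1) (hind : iIndepFun ξ P)
    (hlaw : ∀ j, HasLaw (ξ j) stdComplexGaussian P) (hmeas : ∀ j, Measurable (ξ j))
    {ζ : ℂ} (hζ : IsPrimitiveRoot ζ M) (θ : ℝ) :
    ∫⁻ ω, ∏ k : Fin M, ‖∑ j ∈ Finset.range n,
        ξ j ω * (a j : ℂ) * (ζ ^ (k : ℕ) * circleMap 0 r θ) ^ j‖ₑ⁻¹ ∂P ≤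
      ENNReal.ofReal (3 / √M) ^ M := by
  classical
  set S := Finset.Ioc N (N + M) with hS
  set T := Finset.range n \ S with hT
  have hST : S ⊆ Finset.range n := fun j hj => by
    simp only [hS, Finset.mem_Ioc, Finset.mem_range] at *; omega
  set v : ℂ := Complex.exp (θ * Complex.I) with hv
  have hv1 : ‖v‖ = 1 := Complex.norm_exp_ofReal_mul_I θ
  set A : Fin M → S → ℂ := fun k j => (ζ ^ (k : ℕ) * v) ^ (j : ℕ) with hA
  set c : (T → ℂ) → Fin M → ℂ := fun y k =>
    ∑ j : T, y j * (a j : ℂ) * (ζ ^ (k : ℕ) * circleMap 0 r θ) ^ (j : ℕ) with hc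
  have hsplit : ∀ ω (k : Fin M), ∑ j ∈ Finset.range n,
      ξ j ω * (a j : ℂ) * (ζ ^ (k : ℕ) * circleMap 0 r θ) ^ j =
      c (fun j => ξ j ω) k + ∑ j : S, A k j * ξ j ω := by
    intro ω k
    rw [← Finset.sum_sdiff hST]
    simp only [hc, hA]
    rw [Finset.sum_coe_sort T
      (fun j => ξ j ω * (a j : ℂ) * (ζ ^ (k : ℕ) * circleMap 0 r θ) ^ j),
      Finset.sum_coe_sort S (fun j => (ζ ^ (k : ℕ) * v) ^ j * ξ j ω)]
    congr 1
    refine Finset.sum_congr rfl fun j hj => ?_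
    have hb : (a j : ℂ) * (r : ℂ) ^ j = 1 := by exact_mod_cast hblock j hj
    rw [circleMap_zero, ← hv]
    calc ξ j ω * (a j : ℂ) * (ζ ^ (k : ℕ) * (r * v)) ^ j
        = ((a j : ℂ) * (r : ℂ) ^ j) * ((ζ ^ (k : ℕ) * v) ^ j * ξ j ω) := by ring
      _ = _ := by rw [hb, one_mul]
  simp_rw [hsplit]
  have hYX := (hind.indepFun_finset T S Finset.sdiff_disjoint hmeas)
  have hX : HasLaw (fun ω (j : S) => ξ j ω) (Measure.pi fun _ => stdComplexGaussian) P :=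
    (hind.precomp Subtype.val_injective).hasLaw_pi fun j => hlaw j
  have hY : Measurable fun ω (j : T) => ξ j ω := by fun_prop
  have hYX' : HasLaw (fun ω => ((fun (j : T) => ξ j ω), fun (j : S) => ξ j ω))
      ((P.map fun ω (j : T) => ξ j ω).prod (Measure.pi fun _ => stdComplexGaussian)) P :=
    (indepFun_iff_hasLaw_prodMk_prod ⟨hY.aemeasurable, rfl⟩ hX).1 hYX
  have hF : Measurable fun p : (T → ℂ) × (S → ℂ) =>
      ∏ k : Fin M, ‖c p.1 k + ∑ j, A k j * p.2 j‖ₑ⁻¹ := by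
    refine Finset.measurable_fun_prod _ fun k _ => ?_
    simp only [hc]
    fun_prop
  have : IsProbabilityMeasure (P.map fun ω (j : T) => ξ j ω) :=
    Measure.isProbabilityMeasure_map hY.aemeasurable
  have h1 := hYX'.lintegral_comp hF.aemeasurable
  simp only at h1
  rw [h1, lintegral_prod _ hF.aemeasurable]
  refine (lintegral_mono fun y => lintegral_prod_enorm_inv_le A
    (Real.sqrt_pos.2 (Nat.cast_pos.2 hM)) (fun k l => ?_) (c y)).trans ?_
  · simp only [hA]
    rw [Finset.sum_coe_sort S
      (fun j => (ζ ^ (k : ℕ) * v) ^ j * conj ((ζ ^ (l : ℕ) * v) ^ j)),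
      sum_Ioc_pow_mul_conj_pow N hζ hv1]
    congr 1
    rw [← Complex.ofReal_pow, Real.sq_sqrt (Nat.cast_nonneg _), Complex.ofReal_natCast]
  · simp

/-- If `M` consecutive terms of the series have unit size on the circle of radius `r`, then the
hole probability at `r` is exponentially small in `M`. -/
lemma measure_holeEvent_le {a : ℕ → ℝ} {r : ℝ} (hr : 0 ≤ r) (ha0 : a 0 = 1) {N M : ℕ}
    (hM : 0 < M) (hblock : ∀ j ∈ Finset.Ioc N (N + M), a j * r ^ j = 1) (hind : iIndepFun ξ P)
    (hlaw : ∀ j, HasLaw (ξ j) stdComplexGaussian P) (hmeas : ∀ j, Measurable (ξ j))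
    (hentire : ∀ᵐ ω ∂P, (∀ z : ℂ, Summable fun n => ξ n ω * (a n : ℂ) * z ^ n) ∧
      Differentiable ℂ (gaf a ξ ω)) :
    P (holeEvent a ξ r) ≤ ENNReal.ofReal (3 * Real.exp (-(M : ℝ) / 72)) := by
  set ζ : ℂ := Complex.exp (2 * π * Complex.I / M) with hζdef
  have hζ : IsPrimitiveRoot ζ M := Complex.isPrimitiveRoot_exp M hM.ne'
  have hζn : ∀ k : ℕ, ‖ζ ^ k‖ = 1 := fun k => by rw [norm_pow, hζ.norm'_eq_one hM.ne', one_pow]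
  have hMs : 0 < √(M : ℝ) := Real.sqrt_pos.2 (Nat.cast_pos.2 hM)
  -- With this threshold for `|f 0|` both parts of the estimate are exponentially small.
  set T : ℝ := √M / 6 with hT
  have hTpos : 0 < T := by positivity
  set G : ℕ → ℝ × Ω → ℝ≥0∞ := fun n p => ∏ k : Fin M, ‖∑ j ∈ Finset.range n,
    ξ j p.2 * (a j : ℂ) * (ζ ^ (k : ℕ) * circleMap 0 r p.1) ^ j‖ₑ⁻¹ with hG
  have hGm : ∀ n, Measurable (G n) := fun n => by
    have : Measurable (circleMap 0 r) := (continuous_circleMap 0 r).measurable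
    simp only [hG]
    fun_prop
  -- The lower limit of the integrands of the partial sums is jointly measurable, obeys Fatou's
  -- lemma, and on a hole agrees with the integrand of the full series.
  set H : ℝ × Ω → ℝ≥0∞ := fun p => liminf (fun n => G n p) atTop with hH
  have hHm : Measurable H := Measurable.liminf hGm
  set ν : Measure ℝ := volume.restrict (Ioc 0 (2 * π)) with hν
  have hνmass : ν univ = ENNReal.ofReal (2 * π) := by simp [hν]
  set J : Ω → ℝ≥0∞ := fun ω => ENNReal.ofReal (2 * π)⁻¹ * ∫⁻ θ, H (θ, ω) ∂ν with hJ
  have hJm : Measurable J := hHm.lintegral_prod_left'.const_mul _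
  have hJint : ∫⁻ ω, J ω ∂P ≤ ENNReal.ofReal (3 / √M) ^ M := by
    simp only [hJ]
    rw [lintegral_const_mul _ hHm.lintegral_prod_left', ← lintegral_prod_symm' H hHm]
    have h1 : ∫⁻ p, H p ∂ν.prod P ≤ ENNReal.ofReal (2 * π) * ENNReal.ofReal (3 / √M) ^ M := by
      refine (lintegral_liminf_le hGm).trans (liminf_le_of_frequently_le' ?_)
      refine Eventually.frequently ?_
      filter_upwards [eventually_gt_atTop (N + M)] with n hn
      rw [lintegral_prod _ (hGm n).aemeasurable]
      refine (lintegral_mono fun θ => lintegral_prod_enorm_inv_polynomial_le hM hn hblock hind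
        hlaw hmeas hζ θ).trans ?_
      rw [lintegral_const, hνmass, mul_comm]
    refine (mul_le_mul_right h1 _).trans ?_
    rw [← mul_assoc, ← ENNReal.ofReal_mul (by positivity), inv_mul_cancel₀ (by positivity)]
    simp
  have hsub : holeEvent a ξ r ≤ᵐ[P]
      ({ω | T < ‖ξ 0 ω‖} ∪ {ω | (ENNReal.ofReal T)⁻¹ ^ M ≤ J ω} : Set Ω) := by
    filter_upwards [hentire] with ω hω (hhole : ω ∈ holeEvent a ξ r)
    by_cases h0 : T < ‖ξ 0 ω‖
    · exact Or.inl h0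
    right
    have hgaf0 : gaf a ξ ω 0 = ξ 0 ω := by
      rw [gaf, tsum_eq_single 0 (fun n hn => by simp [hn])]
      simp [ha0]
    have hmv := enorm_inv_pow_le_lintegral_circle hω.2 hr hhole (fun k : Fin M => ζ ^ (k : ℕ))
      fun k => hζn k
    rw [Fintype.card_fin, hgaf0] at hmv
    have hle : (ENNReal.ofReal T)⁻¹ ^ M ≤ ‖ξ 0 ω‖ₑ⁻¹ ^ M := by
      gcongr
      rw [← ofReal_norm]
      exact ENNReal.ofReal_le_ofReal (not_lt.1 h0)
    refine (hle.trans hmv).trans (le_of_eq ?_)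
    simp only [hJ]
    congr 1
    refine lintegral_congr fun θ => ?_
    refine (Tendsto.liminf_eq ?_).symm
    have hne : ∀ k : Fin M, gaf a ξ ω (ζ ^ (k : ℕ) * circleMap 0 r θ) ≠ 0 := fun k =>
      hhole _ (by simp [hζn, abs_of_nonneg hr])
    simp only [hG]
    refine ENNReal.tendsto_finsetProd_of_ne_top _ (fun k _ => ?_) fun k _ => ?_
    · exact ((hω.1 _).hasSum.tendsto_sum_nat.enorm).inv
    · exact ENNReal.inv_ne_top.2 (by simpa using hne k)
  have hTM : ENNReal.ofReal (3 / √M) ^ M / (ENNReal.ofReal T)⁻¹ ^ M =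
      ENNReal.ofReal ((1 / 2) ^ M) := by
    rw [← ENNReal.ofReal_inv_of_pos hTpos, ← ENNReal.ofReal_pow (by positivity),
      ← ENNReal.ofReal_pow (by positivity), ← ENNReal.ofReal_div_of_pos (by positivity), ← div_pow]
    congr 2
    rw [hT]
    field_simp
    norm_num
  have hmark : P {ω | (ENNReal.ofReal T)⁻¹ ^ M ≤ J ω} ≤ ENNReal.ofReal ((1 / 2) ^ M) := by
    rw [← hTM]
    refine (meas_ge_le_lintegral_div hJm.aemeasurable ?_ ?_).trans ?_
    · exact pow_ne_zero _ (ENNReal.inv_ne_zero.2 ENNReal.ofReal_ne_top)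
    · exact ENNReal.pow_ne_top (ENNReal.inv_ne_top.2 (by simpa using hTpos))
    · gcongr
  have htail : P {ω | T < ‖ξ 0 ω‖} ≤ ENNReal.ofReal (2 * Real.exp (-T ^ 2 / 2)) := by
    rw [(hlaw 0).measure_eq (p := fun z => T < ‖z‖)
      (measurableSet_lt measurable_const measurable_norm)]
    exact stdComplexGaussian_lt_norm_le hTpos.le
  refine (measure_mono_ae hsub).trans ((measure_union_le _ _).trans
    ((add_le_add htail hmark).trans ?_))
  rw [← ENNReal.ofReal_add (by positivity) (by positivity)]
  refine ENNReal.ofReal_le_ofReal ?_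
  have h1 : -T ^ 2 / 2 = -(M : ℝ) / 72 := by
    rw [hT, div_pow, Real.sq_sqrt (Nat.cast_nonneg _)]; ring
  have h2 : ((1 : ℝ) / 2) ^ M ≤ Real.exp (-(M : ℝ) / 72) := by
    have : Real.exp (-(M : ℝ) / 72) = Real.exp (-1 / 72) ^ M := by
      rw [← Real.exp_nat_mul]; ring_nf
    rw [this]
    gcongr
    linarith [Real.add_one_le_exp (-1 / 72)]
  rw [h1]
  linarith

end

/-! ### Convergence of the random series and positivity of the hole probability -/

section

variable {Ω : Type*} [MeasurableSpace Ω] {P : Measure Ω}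
  {ξ : ℕ → Ω → ℂ}

lemma ae_tsum_enorm_lt_top {a : ℕ → ℝ} {R : ℝ} (ha : Summable fun n => ‖a n * R ^ n‖)
    (hlaw : ∀ j, HasLaw (ξ j) stdComplexGaussian P) (hmeas : ∀ j, Measurable (ξ j)) :
    ∀ᵐ ω ∂P, ∑' n, ‖ξ n ω‖ₑ * ‖a n * R ^ n‖ₑ < ∞ := by
  refine ae_lt_top (by fun_prop) ?_
  rw [lintegral_tsum (by fun_prop)]
  have : ∀ n, ∫⁻ ω, ‖ξ n ω‖ₑ * ‖a n * R ^ n‖ₑ ∂P =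
      (∫⁻ z, ‖z‖ₑ ∂stdComplexGaussian) * ‖a n * R ^ n‖ₑ := fun n => by
    rw [lintegral_mul_const _ (by fun_prop),
      (hlaw n).lintegral_comp (f := fun z => ‖z‖ₑ) (by fun_prop)]
  simp_rw [this]
  rw [ENNReal.tsum_mul_left]
  refine ENNReal.mul_ne_top lintegral_enorm_stdComplexGaussian_lt_top.ne ?_
  simp_rw [← ofReal_norm]
  exact ha.tsum_ofReal_ne_top

/-- A power series with finite sums `∑ |c n| R ^ n` for all `R` defines an entire function. -/
lemma differentiable_tsum_of_tsum_enorm_lt_top {c : ℕ → ℂ}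
    (hc : ∀ R : ℕ, ∑' n, ‖c n * (R : ℂ) ^ n‖ₑ < ∞) :
    (∀ z : ℂ, Summable fun n => c n * z ^ n) ∧ Differentiable ℂ fun z => ∑' n, c n * z ^ n := by
  have hs : ∀ R : ℕ, Summable fun n => ‖c n * (R : ℂ) ^ n‖ := fun R => by
    simpa using ENNReal.summable_toReal (hc R).ne
  have hle : ∀ (R : ℕ) (z : ℂ), ‖z‖ ≤ R → ∀ n, ‖c n * z ^ n‖ ≤ ‖c n * (R : ℂ) ^ n‖ := by
    intro R z hz n
    rw [norm_mul, norm_mul, norm_pow, norm_pow, Complex.norm_natCast]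
    gcongr
  refine ⟨fun z => ?_, fun z => ?_⟩
  · obtain ⟨R, hR⟩ := exists_nat_ge ‖z‖
    exact (hs R).of_norm_bounded (hle R z hR)
  · obtain ⟨R, hR⟩ := exists_nat_gt ‖z‖
    have := Complex.differentiableOn_tsum_of_summable_norm (F := fun n z => c n * z ^ n)
      (U := Metric.ball (0 : ℂ) R) (hs R) (fun n => by fun_prop) Metric.isOpen_ball
      (fun n w hw => hle R w (mem_ball_zero_iff.1 hw).le n)
    exact (this z (by simpa using hR)).differentiableAt
      (Metric.isOpen_ball.mem_nhds (by simpa using hR))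

lemma ae_differentiable_gaf {a : ℕ → ℝ} (ha : ∀ R : ℕ, Summable fun n => ‖a n * (R : ℝ) ^ n‖)
    (hlaw : ∀ j, HasLaw (ξ j) stdComplexGaussian P) (hmeas : ∀ j, Measurable (ξ j)) :
    ∀ᵐ ω ∂P, (∀ z : ℂ, Summable fun n => ξ n ω * (a n : ℂ) * z ^ n) ∧
      Differentiable ℂ (gaf a ξ ω) := by
  filter_upwards [ae_all_iff.2 fun R : ℕ => ae_tsum_enorm_lt_top (ha R) hlaw hmeas] with ω hω
  refine differentiable_tsum_of_tsum_enorm_lt_top (c := fun n => ξ n ω * (a n : ℂ)) fun R => ?_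
  convert hω R using 3 with n
  rw [mul_assoc, enorm_mul]
  congr 1
  rw [← ofReal_norm, ← ofReal_norm]
  simp

lemma measurable_tsum_enorm_mul {α : Type*} {m : MeasurableSpace α} {η : ℕ → α → ℂ}
    (hη : ∀ n, Measurable (η n)) (c : ℕ → ℝ≥0∞) :
    Measurable fun x => ∑' n, ‖η n x‖ₑ * c n :=
  Measurable.tsum fun n => (hη n).enorm.mul_const _

/-- The hole probability is positive: with positive probability the constant term dominates the
sum of the moduli of all other terms, since the two are independent and the constant term is
unbounded. -/
lemma measure_holeEvent_pos [IsProbabilityMeasure P] {a : ℕ → ℝ} (ha0 : a 0 = 1)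
    (ha : ∀ R : ℝ, Summable fun n => ‖a n * R ^ n‖) (hind : iIndepFun ξ P)
    (hlaw : ∀ j, HasLaw (ξ j) stdComplexGaussian P) (hmeas : ∀ j, Measurable (ξ j)) (r : ℝ) :
    0 < P (holeEvent a ξ r) := by
  set Q : Ω → ℝ≥0∞ := fun ω => ∑' n, ‖ξ (n + 1) ω‖ₑ * ‖a (n + 1) * r ^ (n + 1)‖ₑ with hQ
  have hQtop : ∀ᵐ ω ∂P, Q ω < ∞ := by
    filter_upwards [ae_tsum_enorm_lt_top (ha r) hlaw hmeas] with ω hω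
    exact (ENNReal.tsum_comp_le_tsum_of_injective (add_left_injective 1) _).trans_lt hω
  obtain ⟨t, ht⟩ : ∃ t : ℕ, P {ω | Q ω ≤ t} ≠ 0 := by
    by_contra! h
    have h0 : P (⋃ t : ℕ, {ω | Q ω ≤ t}) = 0 := measure_iUnion_null h
    have hfalse : ∀ᵐ ω ∂P, False := by
      filter_upwards [hQtop, measure_eq_zero_iff_ae_notMem.1 h0] with ω hω hω'
      obtain ⟨t, ht⟩ := ENNReal.exists_nat_gt hω.ne
      exact hω' (mem_iUnion.2 ⟨t, ht.le⟩)
    exact hfalse.exists.elim fun _ h => h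
  have hindep := indep_iSup_of_disjoint (fun i => (hmeas i).comap_le) hind.iIndep
    (S := {0}) (T := {0}ᶜ) disjoint_compl_right
  have hm0 : MeasurableSet[⨆ i ∈ ({0} : Set ℕ), MeasurableSpace.comap (ξ i) inferInstance]
      {ω | (t : ℝ) < ‖ξ 0 ω‖} := by
    have h := measurable_iff_comap_le.2 (le_iSup₂ (f := fun i (_ : i ∈ ({0} : Set ℕ)) =>
      MeasurableSpace.comap (ξ i) inferInstance) 0 rfl)
    exact h (measurableSet_lt (measurable_const (a := (t : ℝ))) measurable_norm)
  have hmQ : MeasurableSet[⨆ i ∈ ({0}ᶜ : Set ℕ), MeasurableSpace.comap (ξ i) inferInstance]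
      {ω | Q ω ≤ t} := by
    have hm : ∀ n : ℕ, @Measurable _ _
        (⨆ i ∈ ({0}ᶜ : Set ℕ), MeasurableSpace.comap (ξ i) inferInstance) _ (ξ (n + 1)) :=
      fun n => measurable_iff_comap_le.2 (le_iSup₂ (f := fun i (_ : i ∈ ({0}ᶜ : Set ℕ)) =>
        MeasurableSpace.comap (ξ i) inferInstance) (n + 1) (Nat.succ_ne_zero n))
    exact measurable_tsum_enorm_mul hm _ (measurableSet_Iic (a := (t : ℝ≥0∞)))
  have hprod := (Indep_iff _ _ _).1 hindep _ _ hm0 hmQ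
  have hpos : 0 < P ({ω | (t : ℝ) < ‖ξ 0 ω‖} ∩ {ω | Q ω ≤ t}) := by
    rw [hprod]
    refine ENNReal.mul_pos ?_ ht
    rw [(hlaw 0).measure_eq (p := fun z => (t : ℝ) < ‖z‖)
      (measurableSet_lt measurable_const measurable_norm)]
    exact (stdComplexGaussian_lt_norm_pos t).ne'
  refine hpos.trans_le (measure_mono ?_)
  rintro ω ⟨hω0 : (t : ℝ) < ‖ξ 0 ω‖, hωQ : Q ω ≤ t⟩ z hz hzero
  have hterm : ∀ n, ‖ξ (n + 1) ω * (a (n + 1) : ℂ) * z ^ (n + 1)‖ₑ ≤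
      ‖ξ (n + 1) ω‖ₑ * ‖a (n + 1) * r ^ (n + 1)‖ₑ := by
    intro n
    rw [mul_assoc, enorm_mul, ← ofReal_norm (_ * _ : ℂ), ← ofReal_norm (_ * _ : ℝ)]
    simp only [norm_mul, norm_pow, Complex.norm_real]
    gcongr
    exact hz.trans (le_abs_self r)
  have hsum : ∑' n, ‖ξ (n + 1) ω * (a (n + 1) : ℂ) * z ^ (n + 1)‖ₑ ≤ t :=
    (ENNReal.tsum_le_tsum hterm).trans hωQ
  have hs : Summable fun n => ξ (n + 1) ω * (a (n + 1) : ℂ) * z ^ (n + 1) := by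
    refine Summable.of_norm ?_
    simpa only [toReal_enorm] using ENNReal.summable_toReal
      (hsum.trans_lt (ENNReal.natCast_lt_top t)).ne
  have hs' : Summable fun n => ξ n ω * (a n : ℂ) * z ^ n := (summable_nat_add_iff 1).1 hs
  rw [gaf, hs'.tsum_eq_zero_add] at hzero
  have heq : ξ 0 ω = -∑' n, ξ (n + 1) ω * (a (n + 1) : ℂ) * z ^ (n + 1) := by
    rw [eq_neg_iff_add_eq_zero, ← hzero]
    simp [ha0]
  have hfin : ‖ξ 0 ω‖ₑ ≤ t := by
    rw [heq, enorm_neg]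
    exact (enorm_tsum_le_tsum_enorm).trans hsum
  rw [← ofReal_norm, ENNReal.ofReal_le_natCast] at hfin
  exact hω0.not_ge hfin

end

/-! ### The coefficients -/

lemma radius_of_pos {m : ℕ} (hm : 1 ≤ m) : radius m = Real.exp (21 ^ m) := by
  rw [radius, if_neg (by omega)]

lemma one_le_radius (m : ℕ) : 1 ≤ radius m := by
  unfold radius
  split_ifs
  · rfl
  · exact Real.one_le_exp (by positivity)

lemma radius_pos (m : ℕ) : 0 < radius m := one_pos.trans_le (one_le_radius m)

lemma radius_mono : Monotone radius := by
  intro m n hmn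
  rcases Nat.eq_zero_or_pos m with rfl | hm
  · simpa [radius] using one_le_radius n
  · rw [radius_of_pos hm, radius_of_pos (hm.trans_le hmn)]
    gcongr
    norm_num

lemma tendsto_radius : Tendsto radius atTop atTop := by
  have h : Tendsto (fun m : ℕ => Real.exp (21 ^ m)) atTop atTop :=
    Real.tendsto_exp_atTop.comp (tendsto_pow_atTop_atTop_of_one_lt (by norm_num))
  refine h.congr' ?_
  filter_upwards [eventually_ge_atTop 1] with m hm
  rw [radius_of_pos hm]

lemma blockEnd_of_pos {m : ℕ} (hm : 1 ≤ m) : blockEnd m = ⌊Real.exp (20 ^ m)⌋₊ := by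
  rw [blockEnd, if_neg (by omega)]

lemma blockEnd_mono : Monotone blockEnd := by
  intro m n hmn
  rcases Nat.eq_zero_or_pos m with rfl | hm
  · simp [blockEnd]
  · rw [blockEnd_of_pos hm, blockEnd_of_pos (hm.trans_le hmn)]
    refine Nat.floor_le_floor ?_
    gcongr
    norm_num

lemma blockEnd_le (m : ℕ) : (blockEnd m : ℝ) ≤ Real.exp (20 ^ m) := by
  unfold blockEnd
  split_ifs
  · simp [Real.exp_nonneg]
  · exact Nat.floor_le (Real.exp_nonneg _)

lemma exists_le_blockEnd (j : ℕ) : ∃ m, j ≤ blockEnd m := by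
  have h : Tendsto (fun m : ℕ => Real.exp (20 ^ m)) atTop atTop :=
    Real.tendsto_exp_atTop.comp (tendsto_pow_atTop_atTop_of_one_lt (by norm_num))
  obtain ⟨m, hm, hm1⟩ := ((h.eventually_ge_atTop (j : ℝ)).and (eventually_ge_atTop 1)).exists
  exact ⟨m, by rw [blockEnd_of_pos hm1]; exact Nat.le_floor hm⟩

lemma lt_blockIndex {m j : ℕ} (h : blockEnd m < j) : m < blockIndex j := by
  by_contra! hle
  have hmem : j ≤ blockEnd (blockIndex j) := Nat.sInf_mem (exists_le_blockEnd j)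
  exact (hmem.trans (blockEnd_mono hle)).not_gt h

lemma blockIndex_le {m j : ℕ} (h : j ≤ blockEnd m) : blockIndex j ≤ m := Nat.sInf_le h

lemma coeff_zero : coeff 0 = 1 := by simp [coeff]

lemma coeff_pos (j : ℕ) : 0 < coeff j := inv_pos.2 (pow_pos (radius_pos _) _)

lemma coeff_le_one (j : ℕ) : coeff j ≤ 1 := inv_le_one_of_one_le₀ (one_le_pow₀ (one_le_radius _))

lemma coeff_mul_radius_pow {m : ℕ} (hm : 1 ≤ m) {j : ℕ} (h1 : blockEnd (m - 1) < j)
    (h2 : j ≤ blockEnd m) : coeff j * radius m ^ j = 1 := by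
  have h : blockIndex j = m := le_antisymm (blockIndex_le h2) (by have := lt_blockIndex h1; omega)
  rw [coeff, h, inv_mul_cancel₀ (pow_ne_zero _ (radius_pos m).ne')]

lemma coeff_mul_pow_le {m j : ℕ} (h : blockEnd m < j) {r : ℝ} (hr : 0 ≤ r) :
    coeff j * r ^ j ≤ (r / radius (m + 1)) ^ j := by
  have := radius_pos (m + 1)
  rw [coeff, div_pow, div_eq_inv_mul]
  gcongr
  exact radius_mono (lt_blockIndex h)

lemma summable_norm_coeff_mul_pow (R : ℝ) : Summable fun n => ‖coeff n * R ^ n‖ := by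
  obtain ⟨m, hm⟩ := ((tendsto_add_atTop_iff_nat 1).2 tendsto_radius).eventually_ge_atTop
    (2 * |R|) |>.exists
  refine Summable.of_norm_bounded_eventually_nat (g := fun n => (1 / 2 : ℝ) ^ n)
    summable_geometric_two ?_
  filter_upwards [eventually_gt_atTop (blockEnd m)] with n hn
  rw [norm_norm, norm_mul, norm_pow, Real.norm_of_nonneg (coeff_pos n).le, Real.norm_eq_abs]
  refine (coeff_mul_pow_le hn (abs_nonneg R)).trans ?_
  have := radius_pos (m + 1)
  refine pow_le_pow_left₀ (by positivity) ?_ n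
  rw [div_le_iff₀ this]
  linarith

lemma summable_coeff_mul_pow (z : ℂ) : Summable fun n => (coeff n : ℂ) * z ^ n := by
  refine Summable.of_norm ((summable_norm_coeff_mul_pow ‖z‖).congr fun n => ?_)
  simp

lemma tsum_coeff_not_constant :
    ∃ z w : ℂ, ∑' n, (coeff n : ℂ) * z ^ n ≠ ∑' n, (coeff n : ℂ) * w ^ n := by
  refine ⟨0, 1, ?_⟩
  have h0 : ∑' n, (coeff n : ℂ) * 0 ^ n = 1 := by
    rw [tsum_eq_single 0 (fun n hn => by simp [hn])]
    simp [coeff_zero]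
  have hs : Summable coeff := by
    simpa using (summable_norm_coeff_mul_pow 1).of_norm
  have h1 : ∑' n, (coeff n : ℂ) * 1 ^ n = ((∑' n, coeff n : ℝ) : ℂ) := by
    simp [Complex.ofReal_tsum]
  rw [h0, h1]
  have hlt : 1 < ∑' n, coeff n := by
    have := hs.sum_le_tsum (Finset.range 2) fun n _ => (coeff_pos n).le
    rw [Finset.sum_range_succ, Finset.sum_range_one, coeff_zero] at this
    linarith [coeff_pos 1]
  exact_mod_cast hlt.ne

/-! ### The function `S` -/

lemma posLog_coeff_mul_pow_eq_zero {m n : ℕ} {r : ℝ} (hr : 0 ≤ r) (hrm : r ≤ radius (m + 1))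
    (hn : blockEnd m < n) : Real.posLog (coeff n * r ^ n) = 0 := by
  rw [Real.posLog_eq_zero_iff, abs_of_nonneg (mul_nonneg (coeff_pos n).le (by positivity))]
  refine (coeff_mul_pow_le hn hr).trans (pow_le_one₀ (by have := radius_pos (m + 1); positivity) ?_)
  exact div_le_one_of_le₀ hrm (radius_pos _).le

lemma S_coeff_eq_sum {m : ℕ} {r : ℝ} (hr : 0 ≤ r) (hrm : r ≤ radius (m + 1)) :
    S coeff r = 2 * ∑ n ∈ Finset.range (blockEnd m + 1), Real.posLog (coeff n * r ^ n) := by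
  rw [S, tsum_eq_sum (s := Finset.range (blockEnd m + 1)) fun n hn =>
    posLog_coeff_mul_pow_eq_zero hr hrm (by rw [Finset.mem_range] at hn; omega)]

lemma tendsto_S_coeff : Tendsto (S coeff) atTop atTop := by
  have h : Tendsto (fun r : ℝ => Real.log (coeff 1 * r)) atTop atTop :=
    Real.tendsto_log_atTop.comp (tendsto_id.const_mul_atTop (coeff_pos 1))
  refine tendsto_atTop_mono' _ ?_ h
  filter_upwards [eventually_ge_atTop 0] with r hr
  obtain ⟨m, hm⟩ := ((tendsto_add_atTop_iff_nat 1).2 tendsto_radius).eventually_ge_atTop r |>.exists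
  have hs : Summable fun n => Real.posLog (coeff n * r ^ n) :=
    summable_of_hasFiniteSupport ((Set.finite_Iic (blockEnd m)).subset fun n hn => by
      by_contra hlt
      exact hn (posLog_coeff_mul_pow_eq_zero hr hm (not_le.1 hlt)))
  have h1 := hs.le_tsum 1 fun n _ => Real.posLog_nonneg
  rw [pow_one] at h1
  have h2 : Real.log (coeff 1 * r) ≤ Real.posLog (coeff 1 * r) := le_max_right _ _
  rw [S]
  linarith [Real.posLog_nonneg (x := coeff 1 * r)]

lemma eta_le_one (m : ℕ) : eta m ≤ 1 := by
  rw [eta, Real.exp_le_one_iff]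
  have : (0 : ℝ) < 20 ^ m := by positivity
  linarith

lemma eta_pos (m : ℕ) : 0 < eta m := Real.exp_pos _

/-- On the `m`-th interval of radii, `S` is at most of order `x ^ 3` with `x = exp (20 ^ (m - 1))`:
the at most `x` earlier nonconstant terms have logarithms at most `x * (21 ^ m + 1)`, and the
`m`-th block contributes at most `k_m ^ 2 η_m ≤ x ^ 2`. -/
lemma S_coeff_le {m : ℕ} (hm : 1 ≤ m) {r : ℝ} (h1 : radius m ≤ r)
    (h2 : r ≤ radius m * Real.exp (eta m)) :
    S coeff r ≤ 174 * Real.exp (20 ^ (m - 1)) ^ 3 := by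
  obtain ⟨l, rfl⟩ : ∃ l, m = l + 1 := ⟨m - 1, by omega⟩
  rw [Nat.add_sub_cancel]
  set x := Real.exp (20 ^ l) with hx
  have hx1 : 1 ≤ x := Real.one_le_exp (by positivity)
  have hr0 : 0 < r := (radius_pos _).trans_le h1
  have hr1 : 1 ≤ r := (one_le_radius _).trans h1
  have hN : (blockEnd l : ℝ) ≤ x := blockEnd_le l
  have hx20 : Real.exp (20 ^ (l + 1)) = x ^ 20 := by
    rw [hx, ← Real.exp_nat_mul]; congr 1; push_cast; ring
  have hK : (blockEnd (l + 1) : ℝ) ≤ x ^ 20 := hx20 ▸ blockEnd_le (l + 1)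
  have heta : x ^ 40 * eta (l + 1) = x ^ 2 := by
    rw [hx, eta, ← Real.exp_nat_mul, ← Real.exp_nat_mul, ← Real.exp_add]
    congr 1; push_cast; ring
  have hlog : Real.log r ≤ 21 ^ (l + 1) + eta (l + 1) := by
    rw [Real.log_le_iff_le_exp hr0, Real.exp_add, ← radius_of_pos hm]
    exact h2
  have hrm : r ≤ radius (l + 1 + 1) := by
    refine h2.trans ?_
    rw [radius_of_pos hm, radius_of_pos (by omega), ← Real.exp_add]
    refine Real.exp_le_exp.2 ?_
    have h21 : (1 : ℝ) ≤ 21 ^ (l + 1) := one_le_pow₀ (by norm_num)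
    rw [pow_succ (21 : ℝ) (l + 1)]
    linarith [eta_le_one (l + 1)]
  have h21 : (21 : ℝ) ^ (l + 1) ≤ 42 * x := by
    have hy : ((20 : ℝ) ^ l) ^ 2 / 2 ≤ x := by
      have := Real.quadratic_le_exp_of_nonneg (x := (20 : ℝ) ^ l) (by positivity)
      have h0 : (0 : ℝ) ≤ 20 ^ l := by positivity
      linarith
    have : (21 : ℝ) ^ l ≤ ((20 : ℝ) ^ l) ^ 2 := by
      rw [← pow_mul, mul_comm, pow_mul]
      gcongr
      norm_num
    rw [pow_succ]
    linarith
  have hposLog : ∀ n, Real.posLog (coeff n * r ^ n) ≤ n * Real.log r := by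
    intro n
    refine (Real.posLog_le_posLog (mul_nonneg (coeff_pos n).le (by positivity))
      (mul_le_of_le_one_left (by positivity) (coeff_le_one n))).trans ?_
    rw [Real.posLog_eq_log (by rw [abs_of_nonneg (by positivity)]; exact one_le_pow₀ hr1),
      Real.log_pow]
  have hfirst : ∑ n ∈ Finset.range (blockEnd l + 1), Real.posLog (coeff n * r ^ n) ≤
      2 * x * (x * (42 * x + 1)) := by
    calc _ ≤ ∑ n ∈ Finset.range (blockEnd l + 1), x * (42 * x + 1) := by
          refine Finset.sum_le_sum fun n hn => (hposLog n).trans ?_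
          have hn' : (n : ℝ) ≤ x := (Nat.cast_le.2 (Finset.mem_range_succ_iff.1 hn)).trans hN
          have := Real.log_nonneg hr1
          gcongr
          linarith [eta_le_one (l + 1)]
      _ ≤ _ := by
          rw [Finset.sum_const, Finset.card_range, nsmul_eq_mul]
          push_cast
          gcongr
          linarith
  have hsecond : ∑ n ∈ Finset.Ico (blockEnd l + 1) (blockEnd (l + 1) + 1),
      Real.posLog (coeff n * r ^ n) ≤ x ^ 2 := by
    calc _ ≤ ∑ n ∈ Finset.Ico (blockEnd l + 1) (blockEnd (l + 1) + 1), x ^ 20 * eta (l + 1) := by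
          refine Finset.sum_le_sum fun n hn => ?_
          rw [Finset.mem_Ico] at hn
          have hblock := coeff_mul_radius_pow (m := l + 1) (by omega) (j := n)
            (by simpa using hn.1) (by omega)
          have hn' : (n : ℝ) ≤ x ^ 20 := (Nat.cast_le.2 (by omega)).trans hK
          have hle : coeff n * r ^ n ≤ Real.exp (n * eta (l + 1)) := by
            calc coeff n * r ^ n ≤ coeff n * (radius (l + 1) * Real.exp (eta (l + 1))) ^ n := by
                  have := coeff_pos n
                  gcongr
              _ = Real.exp (n * eta (l + 1)) := by
                  rw [mul_pow, ← mul_assoc, hblock, one_mul, ← Real.exp_nat_mul]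
          have heta0 := eta_pos (l + 1)
          refine (Real.posLog_le_posLog (mul_nonneg (coeff_pos n).le (by positivity)) hle).trans ?_
          rw [Real.posLog_eq_log (by
            rw [abs_of_nonneg (by positivity)]; exact Real.one_le_exp (by positivity)),
            Real.log_exp]
          gcongr
      _ ≤ x ^ 20 * (x ^ 20 * eta (l + 1)) := by
          have heta0 := eta_pos (l + 1)
          rw [Finset.sum_const, Nat.card_Ico, nsmul_eq_mul]
          gcongr
          refine le_trans (Nat.cast_le.2 ?_) hK
          omega
      _ = x ^ 2 := by rw [← heta]; ring
  rw [S_coeff_eq_sum hr0.le hrm, ← Finset.sum_range_add_sum_Ico _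
    (Nat.succ_le_succ (blockEnd_mono (Nat.le_succ l)))]
  have hx23 : x ^ 2 ≤ x ^ 3 := pow_le_pow_right₀ hx1 (by norm_num)
  nlinarith [hfirst, hsecond]

/-! ### The set of radii -/

lemma nonneg_of_mem_badRadii {r : ℝ} (hr : r ∈ badRadii) : 0 ≤ r := by
  simp only [badRadii, mem_iUnion] at hr
  obtain ⟨m, -, hm⟩ := hr
  exact (radius_pos m).le.trans hm.1

lemma volume_badRadii : volume badRadii = ⊤ := by
  have htend : Tendsto (fun m : ℕ => (20 : ℝ) ^ m * ((21 / 20) ^ m - 19 / 10)) atTop atTop := by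
    refine (tendsto_pow_atTop_atTop_of_one_lt (by norm_num)).atTop_mul_atTop₀ ?_
    exact tendsto_atTop_add_const_right _ _ (tendsto_pow_atTop_atTop_of_one_lt (by norm_num))
  refine ENNReal.eq_top_of_forall_nnreal_le fun B => ?_
  obtain ⟨m, hB, hm⟩ := ((htend.eventually_ge_atTop (B : ℝ)).and (eventually_ge_atTop 1)).exists
  have hsub : Icc (radius m) (radius m * Real.exp (eta m)) ⊆ badRadii :=
    subset_iUnion₂ (s := fun m (_ : 1 ≤ m) => Icc (radius m) (radius m * Real.exp (eta m))) m hm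
  refine le_trans ?_ (measure_mono hsub)
  rw [Real.volume_Icc, ← ENNReal.ofReal_coe_nnreal]
  refine ENNReal.ofReal_le_ofReal ?_
  calc (B : ℝ) ≤ 20 ^ m * ((21 / 20) ^ m - 19 / 10) := hB
    _ = 21 ^ m + -(19 / 10) * 20 ^ m := by
        rw [mul_sub, ← mul_pow]; norm_num; ring
    _ ≤ Real.exp (21 ^ m + -(19 / 10) * 20 ^ m) := by
        linarith [Real.add_one_le_exp (21 ^ m + -(19 / 10) * 20 ^ m : ℝ)]
    _ = radius m * eta m := by rw [Real.exp_add, radius_of_pos hm, eta]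
    _ ≤ radius m * Real.exp (eta m) - radius m := by
        have := radius_pos m
        nlinarith [Real.add_one_le_exp (eta m)]

/-! ### The lower bound for `pH` and the exceptional set -/

section

variable {Ω : Type*} [MeasurableSpace Ω] {P : Measure Ω}
  {ξ : ℕ → Ω → ℂ}

/-- The number `M = k_m - k_{m-1}` of unit terms at radius `r_m` is at least `x ^ 20 - 2 x` with
`x = exp (20 ^ (m - 1))`, whereas `S` is at most of order `x ^ 3`. -/
lemma two_mul_S_le_pH [IsProbabilityMeasure P] (hind : iIndepFun ξ P) (hlaw : ∀ j, HasLaw (ξ j) stdComplexGaussian P)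
    (hmeas : ∀ j, Measurable (ξ j)) {r : ℝ} (hr : r ∈ badRadii) :
    2 * S coeff r ≤ pH P coeff ξ r := by
  simp only [badRadii, mem_iUnion] at hr
  obtain ⟨m, hm, h1, h2⟩ := hr
  have hS := S_coeff_le hm h1 h2
  obtain ⟨l, rfl⟩ : ∃ l, m = l + 1 := ⟨m - 1, by omega⟩
  rw [Nat.add_sub_cancel] at hS
  set x := Real.exp (20 ^ l) with hx
  have hx2 : 2 ≤ x := by
    have h20 : (1 : ℝ) ≤ 20 ^ l := one_le_pow₀ (by norm_num)
    linarith [Real.add_one_le_exp ((20 : ℝ) ^ l)]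
  have hN : (blockEnd l : ℝ) ≤ x := blockEnd_le l
  have hK : x ^ 20 < blockEnd (l + 1) + 1 := by
    have : Real.exp (20 ^ (l + 1)) = x ^ 20 := by
      rw [hx, ← Real.exp_nat_mul]; congr 1; push_cast; ring
    rw [blockEnd_of_pos hm, ← this]
    exact Nat.lt_floor_add_one _
  have hgrow : 131072 * x ^ 3 ≤ x ^ 20 := by
    calc 131072 * x ^ 3 = 2 ^ 17 * x ^ 3 := by norm_num
      _ ≤ x ^ 17 * x ^ 3 := by gcongr
      _ = x ^ 20 := by ring
  have hx3 : x ≤ x ^ 3 := le_self_pow₀ (by linarith) (by norm_num)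
  have hNK : blockEnd l < blockEnd (l + 1) := by
    have : (blockEnd l : ℝ) < blockEnd (l + 1) := by linarith
    exact_mod_cast this
  obtain ⟨M, hM⟩ := Nat.exists_eq_add_of_le hNK.le
  have hMx : x ^ 20 - 2 * x ≤ M := by
    have : (blockEnd (l + 1) : ℝ) = blockEnd l + M := by exact_mod_cast hM
    linarith
  have hblock : ∀ j ∈ Finset.Ioc (blockEnd l) (blockEnd l + M),
      coeff j * radius (l + 1) ^ j = 1 := fun j hj => by
    rw [Finset.mem_Ioc, ← hM] at hj
    exact coeff_mul_radius_pow hm (by simpa using hj.1) hj.2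
  have hsum : ∀ R : ℕ, Summable fun n => ‖coeff n * (R : ℝ) ^ n‖ := fun R =>
    summable_norm_coeff_mul_pow R
  -- A hole of radius `r` contains the hole of radius `r_m`, where the block is exactly unit.
  have hsub : holeEvent coeff ξ r ⊆ holeEvent coeff ξ (radius (l + 1)) :=
    fun ω hω z hz => hω z (hz.trans h1)
  have hP := (measure_mono hsub).trans (measure_holeEvent_le (radius_pos _).le coeff_zero
    (by omega) hblock hind hlaw hmeas (ae_differentiable_gaf hsum hlaw hmeas))
  have hpos := measure_holeEvent_pos coeff_zero summable_norm_coeff_mul_pow hind hlaw hmeas r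
  have hreal : P.real (holeEvent coeff ξ r) ≤ 3 * Real.exp (-(M : ℝ) / 72) :=
    ENNReal.toReal_le_of_le_ofReal (by positivity) hP
  have hrealpos : 0 < P.real (holeEvent coeff ξ r) := ENNReal.toReal_pos hpos.ne' (by finiteness)
  have hlog := Real.log_le_log hrealpos hreal
  rw [Real.log_mul (by norm_num) (Real.exp_ne_zero _), Real.log_exp] at hlog
  have hlog3 : Real.log 3 ≤ 2 := by
    linarith [Real.log_le_sub_one_of_pos (x := 3) (by norm_num)]
  refine le_trans ?_ (le_max_left _ _)
  have h8 : 8 ≤ x ^ 3 := by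
    calc (8 : ℝ) = 2 ^ 3 := by norm_num
      _ ≤ x ^ 3 := by gcongr
  linarith

/-- If `pH` is at least `2 S` on the set of radii `E`, then `pH - S ≥ S` there, which is not
`O(S ^ (1 / 2 + ε))`; an exceptional set must therefore contain `E` up to a bounded set. -/
lemma volume_eq_top_of_pH_sub_S_isBigO
    (hpH : ∀ r ∈ badRadii, 2 * S coeff r ≤ pH P coeff ξ r) {ε : ℝ} (hε : ε < 1 / 2) {F : Set ℝ}
    (hF : (fun r => pH P coeff ξ r - S coeff r) =O[atTop ⊓ 𝓟 Fᶜ]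
      fun r => S coeff r ^ (1 / 2 + ε)) :
    volume F = ⊤ := by
  obtain ⟨c, hc⟩ := hF.bound
  rw [eventually_inf_principal] at hc
  have hgrow : ∀ᶠ r in atTop, c < S coeff r ^ (1 / 2 - ε) :=
    ((tendsto_rpow_atTop (by linarith)).comp tendsto_S_coeff).eventually_gt_atTop c
  obtain ⟨R, hR⟩ := eventually_atTop.1
    (hc.and (hgrow.and (tendsto_S_coeff.eventually_gt_atTop 0)))
  have hsub : badRadii ⊆ F ∪ Icc 0 R := by
    intro r hr
    by_cases hrR : r ≤ R
    · exact Or.inr ⟨nonneg_of_mem_badRadii hr, hrR⟩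
    left
    by_contra hrF
    obtain ⟨hb, hlt, hS⟩ := hR r (not_le.1 hrR).le
    have hb := hb hrF
    rw [Real.norm_of_nonneg (by positivity : 0 ≤ S coeff r ^ (1 / 2 + ε))] at hb
    have h1 : S coeff r ≤ c * S coeff r ^ (1 / 2 + ε) := by
      linarith [hpH r hr, le_abs_self (pH P coeff ξ r - S coeff r),
        Real.norm_eq_abs (pH P coeff ξ r - S coeff r)]
    have h2 : c * S coeff r ^ (1 / 2 + ε) < S coeff r := by
      calc c * S coeff r ^ (1 / 2 + ε) < S coeff r ^ (1 / 2 - ε) * S coeff r ^ (1 / 2 + ε) := by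
            gcongr
        _ = S coeff r := by
            rw [← Real.rpow_add hS]
            norm_num
    linarith
  by_contra hne
  have := (measure_mono hsub).trans (measure_union_le (μ := volume) F (Icc 0 R))
  rw [volume_badRadii, top_le_iff, ENNReal.add_eq_top] at this
  simp [hne] at this

end

end HoleProb

theorem mainTheorem10 :
    -- the block structure of the coefficients
    (HoleProb.coeff 0 = 1 ∧
      ∀ m : ℕ, 1 ≤ m → ∀ j : ℕ, HoleProb.blockEnd (m - 1) < j → j ≤ HoleProb.blockEnd m →
        HoleProb.coeff j * HoleProb.radius m ^ j = 1) ∧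
    -- `∑ a_n z^n` is a non-constant entire function
    (∀ z : ℂ, Summable fun n => (HoleProb.coeff n : ℂ) * z ^ n) ∧
    (∃ z w : ℂ, ∑' n, (HoleProb.coeff n : ℂ) * z ^ n ≠ ∑' n, (HoleProb.coeff n : ℂ) * w ^ n) ∧
    -- the set of radii has infinite Lebesgue measure
    volume HoleProb.badRadii = ⊤ ∧
    ∃ C : ℝ, 0 < C ∧
      ∀ (Ω : Type*) [MeasurableSpace Ω] (P : Measure Ω) [IsProbabilityMeasure P] (ξ : ℕ → Ω → ℂ),
        iIndepFun ξ P → (∀ n, HasLaw (ξ n) HoleProb.stdComplexGaussian P) →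
        -- the random series is almost surely an entire function
        (∀ᵐ ω ∂P, (∀ z : ℂ, Summable fun n => ξ n ω * (HoleProb.coeff n : ℂ) * z ^ n) ∧
          Differentiable ℂ (HoleProb.gaf HoleProb.coeff ξ ω)) ∧
        -- the hole probability is positive, so that its logarithm is the genuine one
        (∀ r : ℝ, 0 < P (HoleProb.holeEvent HoleProb.coeff ξ r)) ∧
        -- the lower bound on the set of radii
        (∀ r ∈ HoleProb.badRadii,
          2 * HoleProb.S HoleProb.coeff r - C * √(HoleProb.S HoleProb.coeff r) ≤
            HoleProb.pH P HoleProb.coeff ξ r) ∧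
        -- an exceptional set in the hole probability asymptotics is unavoidable: any one that
        -- works for this function has infinite Lebesgue measure
        (∀ ε : ℝ, 0 < ε → ε < 1 / 2 → ∀ F : Set ℝ, F ⊆ Ici 1 →
          (fun r => HoleProb.pH P HoleProb.coeff ξ r - HoleProb.S HoleProb.coeff r)
            =O[atTop ⊓ 𝓟 Fᶜ] (fun r => HoleProb.S HoleProb.coeff r ^ (1 / 2 + ε)) →
          volume F = ⊤) := by
  refine ⟨⟨HoleProb.coeff_zero, fun m hm j h1 h2 => HoleProb.coeff_mul_radius_pow hm h1 h2⟩,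
    HoleProb.summable_coeff_mul_pow, HoleProb.tsum_coeff_not_constant, HoleProb.volume_badRadii,
    1, one_pos, ?_⟩
  intro Ω _ P _ ξ hind hlaw
  -- Measurable versions of the coefficients change the power series only on a null set.
  set η : ℕ → Ω → ℂ := fun n => (hlaw n).aemeasurable.mk (ξ n) with hη
  have hae : ∀ n, ξ n =ᵐ[P] η n := fun n => (hlaw n).aemeasurable.ae_eq_mk
  have hmeas : ∀ n, Measurable (η n) := fun n => (hlaw n).aemeasurable.measurable_mk
  have hindη : iIndepFun η P := hind.congr hae
  have hlawη : ∀ n, HasLaw (η n) HoleProb.stdComplexGaussian P :=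
    fun n => (hlaw n).congr (hae n).symm
  have hall : ∀ᵐ ω ∂P, ∀ n, ξ n ω = η n ω := ae_all_iff.2 hae
  have hgaf : ∀ ω, (∀ n, ξ n ω = η n ω) →
      HoleProb.gaf HoleProb.coeff ξ ω = HoleProb.gaf HoleProb.coeff η ω := fun ω hω => by
    funext z
    simp only [HoleProb.gaf, hω]
  have hhole : ∀ r, P (HoleProb.holeEvent HoleProb.coeff ξ r) =
      P (HoleProb.holeEvent HoleProb.coeff η r) := fun r => by
    refine measure_congr (eventuallyEq_set.2 ?_)
    filter_upwards [hall] with ω hω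
    simp only [HoleProb.holeEvent, mem_ofPred_eq, hgaf ω hω]
  have hpH : ∀ r, HoleProb.pH P HoleProb.coeff ξ r = HoleProb.pH P HoleProb.coeff η r := fun r => by
    simp only [HoleProb.pH, Measure.real, hhole]
  have hbound : ∀ r ∈ HoleProb.badRadii,
      2 * HoleProb.S HoleProb.coeff r ≤ HoleProb.pH P HoleProb.coeff ξ r := fun r hr => by
    rw [hpH]
    exact HoleProb.two_mul_S_le_pH hindη hlawη hmeas hr
  refine ⟨?_, fun r => ?_, fun r hr => ?_, fun ε _ hε F _ hF => ?_⟩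
  · filter_upwards [hall, HoleProb.ae_differentiable_gaf
      (fun R => HoleProb.summable_norm_coeff_mul_pow R) hlawη hmeas] with ω hω hd
    rw [hgaf ω hω]
    simpa only [hω] using hd
  · rw [hhole]
    exact HoleProb.measure_holeEvent_pos HoleProb.coeff_zero HoleProb.summable_norm_coeff_mul_pow
      hindη hlawη hmeas r
  · linarith [hbound r hr, Real.sqrt_nonneg (HoleProb.S HoleProb.coeff r)]
  · exact HoleProb.volume_eq_top_of_pH_sub_S_isBigO hbound hε hF
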